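/- Let $\mathbb F_q$ be a finite field and let $m_0,m_1,m_2,m_3,m_4$ be non-negative integers with $m_2+m_1<m_0$. Network and attack. For non-negative integers $m_5,m_6$ consider a linear network given by matrices $K_B\in\mathbb F_q^{m_4\times m_3}$, $H_B\in\mathbb F_q^{m_4\times m_5}$, $K_E\in\mathbb F_q^{m_6\times m_3}$, $H_E\in\mathbb F_q^{m_6\times m_5}$ that stay fixed during all uses. In $l$ uses of the network Alice inputs $X\in\mathbb F_q^{m_3\times l}$, Eve injects $Z\in\mathbb F_q^{m_5\times l}$, and Bob and Eve observe $Y_B=K_BX+H_BZ$ and $Y_E=K_EX+H_EZ$. Eve's strategy is a function $\alpha$ with $Z=\alpha(Y_E)$ that satisfies the uniqueness condition: for every $X$ there is exactly one $Y_E$ with $Y_E=K_EX+H_E\,\alpha(Y_E)$. (In particular every sequential strategy is included, that is, every strategy in which the edges are used in a fixed order, each injected symbol reaches only wiretapped edges that come later, and each injected symbol depends only on what was wiretapped up to that point.) Codes. A non-local code $\Phi=(\phi,\psi)$ of block-length $l$ with message set $\mathbb F_q^{k}$ consists of a finite non-empty set $\mathcal L$, an encoder $\phi:\mathbb F_q^{k}\times\mathcal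 L\to\mathbb F_q^{m_3\times l}$ and a decoder $\psi:\mathbb F_q^{m_4\times l}\to\mathbb F_q^{k}$. The message $M$ and the scramble random number $L\in\mathcal L$ are independent and uniformly distributed, and $X=\phi(M,L)$. Write $P_e[\Phi,\boldsymbol K,\boldsymbol H,\alpha]$ for the probability that $\psi(Y_B)\neq M$, and $I(M;Y_E)[\Phi,\boldsymbol K,\boldsymbol H,\alpha]$ for the mutual information of $M$ and $Y_E$, where $\boldsymbol K=(K_B,K_E)$ and $\boldsymbol H=(H_B,H_E)$. Claim. There is a sequence of non-local codes $\Phi_n$ over $\mathbb F_q$, with block-lengths $l_n\to\infty$ and message sets $\mathbb F_q^{k_n}$, such that $$\lim_{n\to\infty}\frac{k_n}{l_n}=m_0-m_1-m_2,$$ $$\lim_{n\to\infty}\ \sup_{\boldsymbol K,\boldsymbol H}\ \sup_{\alpha}\ P_e[\Phi_n,\boldsymbol K,\boldsymbol H,\alpha]=0,$$ $$\sup_{\boldsymbol K,\boldsymbol H}\ \sup_{\alpha}\ I(M;Y_E)[\Phi_n,\boldsymbol K,\boldsymbol H,\alpha]=0\quad\text{for every } n,$$ where the suprema run over all $m_5,m_6$,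 all matrices $K_B,H_B,K_E,H_E$ as above with $\operatorname{rank}K_B=m_0$, $\operatorname{rank}H_B\le m_1$, $\operatorname{rank}K_E\le m_2$, and all strategies $\alpha$ of Eve for $l_n$ uses that satisfy the uniqueness condition (a supremum over an empty set being $0$). Thus the codes depend only on $q,m_0,m_1,m_2,m_3,m_4$. -/

import Mathlib

open Filter Topology

/-- A linear network over `F` under a wiretap and addition attack. Alice's input has dimension `m3`,
Bob's output `m4`, Eve's injected information `m5` and Eve's wiretapped information `m6`.
One use of the network gives `Y_B = K_B X + H_B Z` and `Y_E = K_E X + H_E Z`. -/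
structure LinearNetwork (F : Type*) (m3 m4 m5 m6 : ℕ) where
  KB : Matrix (Fin m4) (Fin m3) F
  HB : Matrix (Fin m4) (Fin m5) F
  KE : Matrix (Fin m6) (Fin m3) F
  HE : Matrix (Fin m6) (Fin m5) F

/-- A strategy of Eve for `n` uses of the network: the injected information `Z^n` as a function of
the wiretapped information `Y_E^n`. -/
abbrev Strategy (F : Type*) (m5 m6 n : ℕ) :=
  Matrix (Fin m6) (Fin n) F → Matrix (Fin m5) (Fin n) F

/-- The uniqueness condition: for every input `X^n`, the equation
`Y_E^n = K_E X^n + H_E α(Y_E^n)` determines Eve's observation `Y_E^n`. -/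
def UniquenessCondition {F : Type*} [Field F] {m3 m4 m5 m6 n : ℕ}
    (N : LinearNetwork F m3 m4 m5 m6) (α : Strategy F m5 m6 n) : Prop :=
  ∀ X : Matrix (Fin m3) (Fin n) F,
    ∃! Y : Matrix (Fin m6) (Fin n) F, Y = N.KE * X + N.HE * α Y

/-- A sequential strategy in a causal network: Eve wiretaps the edges numbered
`ζ 0 < ζ 1 < …` and injects on the edges numbered `η 0 < η 1 < …`, information travels along the
edges in the order of their numbers, and what is injected on edge `η i` depends only on
what was wiretapped on the edges `ζ j ≤ η i`. -/
def IsSequential {F : Type*} [Field F] {m3 m4 m5 m6 n : ℕ}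
    (N : LinearNetwork F m3 m4 m5 m6) (α : Strategy F m5 m6 n) : Prop :=
  ∃ (ζ : Fin m6 → ℕ) (η : Fin m5 → ℕ), StrictMono ζ ∧ StrictMono η ∧
    (∀ j i, ζ j ≤ η i → N.HE j i = 0) ∧
    ∀ (i : Fin m5) (Y Y' : Matrix (Fin m6) (Fin n) F),
      (∀ j, ζ j ≤ η i → ∀ t, Y j t = Y' j t) → ∀ t, α Y i t = α Y' i t

/-- Every sequential strategy satisfies the uniqueness condition. -/
theorem IsSequential.uniquenessCondition {F : Type*} [Field F] [Finite F] {m3 m4 m5 m6 n : ℕ}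
    {N : LinearNetwork F m3 m4 m5 m6} {α : Strategy F m5 m6 n} (h : IsSequential N α) :
    UniquenessCondition N α := by
  obtain ⟨ζ, η, -, -, hH, hα⟩ := h
  have hinj : Function.Injective
      (fun Y : Matrix (Fin m6) (Fin n) F => Y - N.HE * α Y) := by
    intro Y Y' hY
    have key : ∀ c : ℕ, ∀ j, ζ j = c → ∀ t, Y j t = Y' j t := by
      intro c
      induction c using Nat.strong_induction_on with
      | _ c ih =>
        intro j hj t
        have h1 : Y j t - (N.HE * α Y) j t = Y' j t - (N.HE * α Y') j t :=
          congrFun (congrFun hY j) t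
        have h2 : (N.HE * α Y) j t = (N.HE * α Y') j t := by
          rw [Matrix.mul_apply, Matrix.mul_apply]
          refine Finset.sum_congr rfl fun i _ => ?_
          by_cases hi : ζ j ≤ η i
          · rw [hH j i hi, zero_mul, zero_mul]
          · rw [hα i Y Y' (fun j' hj' => ih (ζ j') (by omega) j' rfl) t]
        rw [h2] at h1
        exact sub_left_injective h1
    ext j t
    exact key _ j rfl t
  have hsurj := Finite.surjective_of_injective hinj
  intro X
  obtain ⟨Y, hY⟩ := hsurj (N.KE * X)
  refine ⟨Y, sub_eq_iff_eq_add.mp hY, fun Y' hY' => hinj ?_⟩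
  exact (sub_eq_iff_eq_add.mpr hY').trans hY.symm

/-- Eve's observation `Y_E^n` when Alice inputs `X^n` and Eve uses the strategy `α`. -/
noncomputable def eveOutput {F : Type*} [Field F] {m3 m4 m5 m6 n : ℕ}
    (N : LinearNetwork F m3 m4 m5 m6) (α : Strategy F m5 m6 n) (hα : UniquenessCondition N α)
    (X : Matrix (Fin m3) (Fin n) F) : Matrix (Fin m6) (Fin n) F :=
  (hα X).exists.choose

/-- Bob's observation `Y_B^n = K_B X^n + H_B Z^n` with `Z^n = α(Y_E^n)`. -/
noncomputable def bobOutput {F : Type*} [Field F] {m3 m4 m5 m6 n : ℕ}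
    (N : LinearNetwork F m3 m4 m5 m6) (α : Strategy F m5 m6 n) (hα : UniquenessCondition N α)
    (X : Matrix (Fin m3) (Fin n) F) : Matrix (Fin m4) (Fin n) F :=
  N.KB * X + N.HB * α (eveOutput N α hα X)

/-- A non-local code of block-length `n` with message set `F^k` and a finite non-empty
set `{0, …, s - 1}` of values of the scramble random number. -/
structure NonLocalCode (F : Type*) (m3 m4 n k : ℕ) where
  s : ℕ
  s_pos : 0 < s
  enc : (Fin k → F) → Fin s → Matrix (Fin m3) (Fin n) F
  dec : Matrix (Fin m4) (Fin n) F → (Fin k → F)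

/-- The probability of an event under the uniform distribution on a finite set. -/
noncomputable def uniformProb {Ω : Type*} [Finite Ω] (p : Ω → Prop) : ℝ :=
  (Nat.card {ω // p ω} : ℝ) / (Nat.card Ω : ℝ)

/-- The mutual information `I(U; V)` (natural logarithm, `0 log 0 = 0`) of two random variables with
values in finite sets on a finite uniform probability space. -/
noncomputable def mutualInformation {Ω A B : Type*} [Finite Ω] [Finite A] [Finite B]
    (U : Ω → A) (V : Ω → B) : ℝ :=
  ∑ᶠ (a : A) (b : B), uniformProb (fun ω => U ω = a ∧ V ω = b) *
    Real.log (uniformProb (fun ω => U ω = a ∧ V ω = b) /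
      (uniformProb (fun ω => U ω = a) * uniformProb (fun ω => V ω = b)))

/-- The decoding error probability `P_e[Φ, K, H, α]`; the message and the scramble random number are
independent and uniform. -/
noncomputable def errorProb {F : Type*} [Field F] [Finite F] {m3 m4 m5 m6 n k : ℕ}
    (Φ : NonLocalCode F m3 m4 n k) (N : LinearNetwork F m3 m4 m5 m6) (α : Strategy F m5 m6 n)
    (hα : UniquenessCondition N α) : ℝ :=
  uniformProb fun ω : (Fin k → F) × Fin Φ.s =>
    Φ.dec (bobOutput N α hα (Φ.enc ω.1 ω.2)) ≠ ω.1

/-- The leaked information `I(M; Y_E^n)[Φ, K, H, α]`; the message and the scramble random number are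
independent and uniform. -/
noncomputable def leakedInformation {F : Type*} [Field F] [Finite F] {m3 m4 m5 m6 n k : ℕ}
    (Φ : NonLocalCode F m3 m4 n k) (N : LinearNetwork F m3 m4 m5 m6) (α : Strategy F m5 m6 n)
    (hα : UniquenessCondition N α) : ℝ :=
  mutualInformation (fun ω : (Fin k → F) × Fin Φ.s => ω.1)
    (fun ω => eveOutput N α hα (Φ.enc ω.1 ω.2))

/-! Put D = m0 - m1 = m2 + d. A main block carries the message and m2 random padding symbols as one
codeword of a rank-metric (Gabidulin) code over K₁, the extension of degree b³. Any observation of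
rank at most m2 can be simulated by the padding alone, so Eve learns nothing (`exists_act_moore_eq`,
`exists_scramble_map`). Bob does not know the network, but some matrix E annihilates `HB` while E *
`KB` keeps rank at least D. There are finitely many guesses for (E, E * `KB`), a number independent
of b, and each guess leaves at most one explanation of the main block (`act_moore_injective`).

A polynomial hash over K₂, the extension of degree b, selects the right explanation, provided its
key and value reach Bob reliably and secretly. They travel as bits, one per side block: a block is a
padded codeword of dimension m2, plus full random noise when the bit is set. The padding hides the
bit from Eve. Bob tests whether some guess explains the block without noise. Since D > m2 there is a
direction invisible to Eve that survives Bob's projection; noise along it cannot be cancelled by Eve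
except with probability 1/|K₂| per guess (`sideFailure_le`). As Eve's view can be kept fixed while
the key varies, her injection is independent of the key, and a wrong explanation passes the hash
with probability at most n/|K₂| (`hashFailure_le`).

Adaptivity costs nothing: by the uniqueness condition the injection is a function of `KE` * X. A
union bound gives error O(b³/q^b), while the side blocks cost only 2qb² symbols against b³. -/

section MatrixAction

variable {F : Type*} [Field F] {ι κ μ : Type*} [Fintype κ] [Fintype μ]
  {V W : Type*} [AddCommGroup V] [Module F V] [AddCommGroup W] [Module F W]

/-- The action of a matrix on vectors with entries in a module. -/
def Matrix.act (E : Matrix ι κ F) : (κ → V) →ₗ[F] (ι → V) where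
  toFun x i := ∑ j, E i j • x j
  map_add' x y := by
    ext i
    simp [Finset.sum_add_distrib]
  map_smul' c x := by
    ext i
    simp only [Pi.smul_apply, RingHom.id_apply, Finset.smul_sum]
    exact Finset.sum_congr rfl fun j _ => smul_comm _ _ _

theorem Matrix.act_apply (E : Matrix ι κ F) (x : κ → V) (i : ι) :
    E.act x i = ∑ j, E i j • x j := rfl

theorem Matrix.act_comp (E : Matrix ι κ F) (f : V →ₗ[F] W) (x : κ → V) (i : ι) :
    E.act (fun j => f (x j)) i = f (E.act x i) := by
  simp [Matrix.act_apply, map_sum]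

theorem Matrix.act_mul (E : Matrix ι κ F) (B : Matrix κ μ F) (x : μ → V) :
    (E * B).act x = E.act (B.act x) := by
  ext i
  simp only [Matrix.act_apply, Matrix.mul_apply, Finset.sum_smul, Finset.smul_sum, mul_smul]
  exact Finset.sum_comm

theorem Matrix.act_smul_right (E : Matrix ι κ F) (ν : κ → F) (v : V) (i : ι) :
    E.act (fun j => ν j • v) i = (E.mulVec ν) i • v := by
  simp [Matrix.act_apply, Matrix.mulVec, dotProduct, Finset.sum_smul, mul_smul]

theorem Matrix.act_zero_left (x : κ → V) : (0 : Matrix ι κ F).act x = 0 := by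
  ext i
  simp [Matrix.act_apply]

end MatrixAction

/-! ### Rank inequalities and factorizations. -/

section Rank

theorem Submodule.finrank_comap_subtype_le {F V : Type*} [Field F] [AddCommGroup V] [Module F V]
    [FiniteDimensional F V] (C U : Submodule F V) :
    Module.finrank F (U.comap C.subtype) ≤ Module.finrank F U := by
  rw [← Submodule.finrank_map_subtype_eq, Submodule.map_comap_subtype]
  exact Submodule.finrank_mono inf_le_right

variable {F : Type*} [Field F] {ι κ μ : Type*} [Fintype κ] [Fintype μ]

/-- Sylvester's inequality, from rank-nullity for `E` restricted to the range of `B`. It bounds the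
rank left after Bob annihilates the injection. -/
theorem Matrix.rank_add_rank_le_rank_mul (E : Matrix ι κ F) (B : Matrix κ μ F) :
    E.rank + B.rank ≤ (E * B).rank + Fintype.card κ := by
  classical
  have h1 := LinearMap.finrank_range_add_finrank_ker
    (E.mulVecLin.domRestrict (LinearMap.range B.mulVecLin))
  have h2 := LinearMap.finrank_range_add_finrank_ker E.mulVecLin
  have h3 : LinearMap.range (E.mulVecLin.domRestrict (LinearMap.range B.mulVecLin)) =
      LinearMap.range (E * B).mulVecLin := by
    rw [LinearMap.range_domRestrict, Matrix.mulVecLin_mul, LinearMap.range_comp]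
  have h4 : Module.finrank F
      (LinearMap.ker (E.mulVecLin.domRestrict (LinearMap.range B.mulVecLin))) ≤
      Module.finrank F (LinearMap.ker E.mulVecLin) := by
    rw [LinearMap.ker_domRestrict]
    exact Submodule.finrank_comap_subtype_le _ _
  rw [h3] at h1
  rw [Module.finrank_fintype_fun_eq_card] at h2
  simp only [Matrix.rank]
  omega

theorem Matrix.exists_mulVec_eq_zero_of_rank_lt {ι' : Type*} [Fintype ι'] (E : Matrix ι κ F)
    (B : Matrix ι' κ F) (h : E.rank < B.rank) :
    ∃ ν : κ → F, E.mulVec ν = 0 ∧ B.mulVec ν ≠ 0 := by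
  classical
  by_contra! hc
  have hle : LinearMap.ker E.mulVecLin ≤ LinearMap.ker B.mulVecLin := fun v hv => hc v hv
  have h1 := LinearMap.finrank_range_add_finrank_ker E.mulVecLin
  have h2 := LinearMap.finrank_range_add_finrank_ker B.mulVecLin
  have h3 := Submodule.finrank_mono hle
  simp only [Matrix.rank] at h
  omega

/-- Take the projection onto a complement along the range of `H`; its kernel is exactly that range.
-/
theorem Matrix.exists_left_annihilator (H : Matrix κ μ F) :
    ∃ E : Matrix κ κ F, E * H = 0 ∧ E.rank + H.rank = Fintype.card κ := by
  classical
  obtain ⟨U, hU⟩ := Submodule.exists_isCompl (LinearMap.range H.mulVecLin)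
  let f : (κ → F) →ₗ[F] (κ → F) := U.subtype ∘ₗ Submodule.projectionOnto U _ hU.symm
  have hker : LinearMap.ker f = LinearMap.range H.mulVecLin := by
    rw [LinearMap.ker_comp_of_ker_eq_bot _ (Submodule.ker_subtype U)]
    exact Submodule.ker_projectionOnto hU.symm
  have hE : (LinearMap.toMatrix' f).mulVecLin = f := by
    rw [← Matrix.toLin'_apply', Matrix.toLin'_toMatrix']
  refine ⟨LinearMap.toMatrix' f, ?_, ?_⟩
  · apply Matrix.toLin'.injective
    ext1 v
    rw [Matrix.toLin'_mul, Matrix.toLin'_toMatrix']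
    ext1
    simp only [LinearMap.comp_apply, map_zero, LinearMap.zero_apply]
    have : Matrix.toLin' H (LinearMap.single F (fun _ => F) v 1) ∈ LinearMap.ker f := by
      rw [hker]
      exact ⟨_, rfl⟩
    rw [LinearMap.mem_ker.mp this]
  · have h := LinearMap.finrank_range_add_finrank_ker f
    rw [hker, Module.finrank_fintype_fun_eq_card] at h
    rw [Matrix.rank, Matrix.rank, hE]
    exact h

/-- Divide out only a part of the kernel, of codimension exactly `m`, so that the quotient is F^m.
This enlarges an eavesdropper to rank exactly `m`, where injectivity of the padding gives
surjectivity. -/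
theorem Matrix.exists_eq_mul_of_rank_le (E : Matrix ι κ F) {m : ℕ} (hE : E.rank ≤ m)
    (hm : m ≤ Fintype.card κ) :
    ∃ (C : Matrix ι (Fin m) F) (B : Matrix (Fin m) κ F), m ≤ B.rank ∧ E = C * B := by
  classical
  have h1 := LinearMap.finrank_range_add_finrank_ker E.mulVecLin
  rw [Module.finrank_fintype_fun_eq_card] at h1
  rw [Matrix.rank] at hE
  obtain ⟨f, hf⟩ := exists_linearIndependent_of_le_finrank (R := F)
    (M := LinearMap.ker E.mulVecLin) (n := Fintype.card κ - m) (by omega)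
  have hg : LinearIndependent F fun i => (f i : κ → F) :=
    hf.map' (Submodule.subtype _) (Submodule.ker_subtype _)
  set U := Submodule.span F (Set.range fun i => (f i : κ → F)) with hU
  have hUrk : Module.finrank F U = Fintype.card κ - m := by
    rw [hU, finrank_span_eq_card hg, Fintype.card_fin]
  have hUle : U ≤ LinearMap.ker E.mulVecLin := by
    rw [hU, Submodule.span_le]
    rintro _ ⟨i, rfl⟩
    exact (f i).2
  have hquot : Module.finrank F ((κ → F) ⧸ U) = Module.finrank F (Fin m → F) := by
    have := Submodule.finrank_quotient_add_finrank U
    rw [Module.finrank_fintype_fun_eq_card] at this ⊢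
    rw [Fintype.card_fin]
    omega
  let e := LinearEquiv.ofFinrankEq _ _ hquot
  let B : (κ → F) →ₗ[F] (Fin m → F) := e.toLinearMap ∘ₗ U.mkQ
  let C : (Fin m → F) →ₗ[F] (ι → F) := U.liftQ E.mulVecLin hUle ∘ₗ e.symm.toLinearMap
  refine ⟨LinearMap.toMatrix' C, LinearMap.toMatrix' B, ?_, ?_⟩
  · have hB : LinearMap.range B = ⊤ :=
      LinearMap.range_eq_top.mpr (e.surjective.comp U.mkQ_surjective)
    rw [Matrix.rank, ← Matrix.toLin'_apply', Matrix.toLin'_toMatrix', hB, finrank_top]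
    simp
  · apply Matrix.toLin'.injective
    rw [Matrix.toLin'_mul, Matrix.toLin'_toMatrix', Matrix.toLin'_toMatrix', Matrix.toLin'_apply']
    ext1 v
    ext1
    simp [B, C]

theorem finrank_span_range_act {K : Type*} [AddCommGroup K] [Module F K] [Finite ι]
    (B : Matrix ι κ F) {a : κ → K}
    (ha : LinearIndependent F a) :
    Module.finrank F (Submodule.span F (Set.range (B.act a))) = B.rank := by
  have h1 : Set.range (B.act a) = Fintype.linearCombination F a '' Set.range B.row := by
    rw [← Set.range_comp]
    rfl
  rw [h1, Submodule.span_image, Matrix.rank_eq_finrank_span_row]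
  exact (Submodule.equivMapOfInjective _
    ha.fintypeLinearCombination_injective _).finrank_eq.symm

end Rank

/-! ### Linearized polynomials and Moore matrices. -/

section Moore

variable {F K : Type*} [Field F] [Fintype F] [Field K] [Algebra F K]

/-- The map `x ↦ ∑ j, t j * x ^ q ^ j` of a field containing the field with `q` elements. -/
noncomputable def linPoly (F : Type*) {K : Type*} [Field F] [Fintype F] [Field K] [Algebra F K]
    {m : ℕ} (t : Fin m → K) : K →ₗ[F] K :=
  ∑ j : Fin m, t j • (FiniteField.frobeniusAlgHom F K ^ (j : ℕ)).toLinearMap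

theorem linPoly_apply {m : ℕ} (t : Fin m → K) (x : K) :
    linPoly F t x = ∑ j : Fin m, t j * x ^ Fintype.card F ^ (j : ℕ) := by
  simp [linPoly, FiniteField.coe_frobeniusAlgHom, AlgHom.coe_pow, pow_iterate]

/-- The kernel consists of roots of a nonzero polynomial of degree at most q^(m-1), and it has q^dim
elements. -/
theorem finrank_ker_linPoly_lt [Finite K] {m : ℕ} (t : Fin m → K) (ht : t ≠ 0) :
    Module.finrank F (LinearMap.ker (linPoly F t)) < m := by
  classical
  have := Fintype.ofFinite K
  set q := Fintype.card F with hq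
  have hq1 : 1 < q := Fintype.one_lt_card
  let p : Polynomial K := ∑ j : Fin m, Polynomial.C (t j) * Polynomial.X ^ q ^ (j : ℕ)
  have hcoeff : ∀ j : Fin m, p.coeff (q ^ (j : ℕ)) = t j := by
    intro j
    simp only [p, Polynomial.finsetSum_coeff, Polynomial.coeff_C_mul_X_pow]
    rw [Finset.sum_eq_single j]
    · simp
    · intro i _ hij
      rw [if_neg]
      intro h
      exact hij (Fin.ext (Nat.pow_right_injective hq1 h).symm)
    · simp
  have hp : p ≠ 0 := by
    intro h
    exact ht (funext fun j => by rw [← hcoeff j, h]; simp)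
  have hm : 0 < m := by
    rcases Nat.eq_zero_or_pos m with rfl | h
    · exact absurd (Subsingleton.elim t 0) ht
    · exact h
  have hdeg : p.natDegree ≤ q ^ (m - 1) := by
    refine Polynomial.natDegree_sum_le_of_forall_le _ _ fun j _ => ?_
    refine (Polynomial.natDegree_C_mul_X_pow_le _ _).trans ?_
    exact Nat.pow_le_pow_right (by omega) (by omega)
  have hroots : Fintype.card (LinearMap.ker (linPoly F t)) ≤ p.natDegree := by
    rw [Fintype.card_subtype]
    refine (Finset.card_le_card ?_).trans
      ((Multiset.toFinset_card_le p.roots).trans (Polynomial.card_roots' p))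
    intro x hx
    have hx' : linPoly F t x = 0 := by simpa using hx
    rw [Multiset.mem_toFinset, Polynomial.mem_roots hp]
    simpa [p, Polynomial.IsRoot, Polynomial.eval_finsetSum, linPoly_apply] using hx'
  rw [Module.card_eq_pow_finrank (K := F)] at hroots
  have := (Nat.pow_le_pow_iff_right hq1).mp (hroots.trans hdeg)
  omega

/-- The product of the Moore matrix of `a` with `t`. -/
noncomputable def moore (F : Type*) {K : Type*} [Field F] [Fintype F] [Field K] [Algebra F K]
    {κ : Type*} {m : ℕ} (a : κ → K) (t : Fin m → K) : κ → K :=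
  fun i => linPoly F t (a i)

variable {ι κ : Type*}

theorem moore_add {m : ℕ} (a : κ → K) (t t' : Fin m → K) :
    moore F a (t + t') = moore F a t + moore F a t' := by
  ext i
  simp [moore, linPoly_apply, add_mul, Finset.sum_add_distrib]

theorem moore_sub {m : ℕ} (a : κ → K) (t t' : Fin m → K) :
    moore F a (t - t') = moore F a t - moore F a t' := by
  ext i
  simp [moore, linPoly_apply, sub_mul, Finset.sum_sub_distrib]

theorem moore_append {m n : ℕ} (a : κ → K) (t : Fin m → K) (t' : Fin n → K) :
    moore F a (Fin.append t t') =
      moore F a t + moore F a (Fin.append (0 : Fin m → K) t') := by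
  ext i
  simp [moore, linPoly_apply, Fin.sum_univ_add]

variable [Fintype κ]

theorem act_moore {m : ℕ} (B : Matrix ι κ F) (a : κ → K) (t : Fin m → K) (i : ι) :
    B.act (moore F a t) i = linPoly F t (B.act a i) :=
  B.act_comp (linPoly F t) a i

variable [Fintype ι]

/-- The entries of `B.act a` span a space of dimension `B.rank`, too large for the kernel of the
linearized polynomial of `t - t'` unless that vanishes. -/
theorem act_moore_injective [Finite K] {m : ℕ} (B : Matrix ι κ F) {a : κ → K}
    (ha : LinearIndependent F a) (hB : m ≤ B.rank) {t t' : Fin m → K}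
    (h : B.act (moore F a t) = B.act (moore F a t')) : t = t' := by
  by_contra hne
  have hlt := finrank_ker_linPoly_lt (F := F) (t - t') (sub_ne_zero.mpr hne)
  have hle : Submodule.span F (Set.range (B.act a)) ≤ LinearMap.ker (linPoly F (t - t')) := by
    rw [Submodule.span_le]
    rintro _ ⟨i, rfl⟩
    have := congrFun h i
    rw [act_moore, act_moore] at this
    rw [SetLike.mem_coe, LinearMap.mem_ker, ← act_moore, moore_sub, map_sub, Pi.sub_apply,
      act_moore, act_moore, this, sub_self]
  have := Submodule.finrank_mono hle
  rw [finrank_span_range_act B ha] at this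
  omega

/-- If `t` were nonzero, the span of `B.act a`, of dimension above `m`, would map into a line and so
meet the kernel in dimension at least `m`. The one spare dimension of `B` is what separates noise
from padding. -/
theorem eq_zero_of_act_moore_eq_smul [Finite K] {m : ℕ} (B : Matrix ι κ F) {a : κ → K}
    (ha : LinearIndependent F a) (hB : m < B.rank) {t : Fin m → K} {d : ι → F} {v : K}
    (h : ∀ i, B.act (moore F a t) i = d i • v) (i : ι) : d i • v = 0 := by
  by_cases ht : t = 0
  · rw [← h i, act_moore, ht]
    simp [linPoly_apply]
  exfalso
  have hlt := finrank_ker_linPoly_lt (F := F) t ht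
  set C := Submodule.span F (Set.range (B.act a)) with hC
  have hrk := LinearMap.finrank_range_add_finrank_ker ((linPoly F t).domRestrict C)
  have h1 : Module.finrank F (LinearMap.range ((linPoly F t).domRestrict C)) ≤ 1 := by
    refine le_trans (Submodule.finrank_mono (t := Submodule.span F {v}) ?_)
      ((finrank_span_le_card {v}).trans (by simp))
    rw [LinearMap.range_domRestrict, hC, Submodule.map_span_le]
    rintro _ ⟨i, rfl⟩
    rw [← act_moore, h i]
    exact Submodule.smul_mem _ _ (Submodule.mem_span_singleton_self v)
  have h2 : Module.finrank F (LinearMap.ker ((linPoly F t).domRestrict C)) ≤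
      Module.finrank F (LinearMap.ker (linPoly F t)) := by
    rw [LinearMap.ker_domRestrict]
    exact Submodule.finrank_comap_subtype_le _ _
  rw [finrank_span_range_act B ha] at hrk
  omega

/-- After factoring `E` through F^m, padding ↦ observation is an injective self-map of the finite
set K^m, hence onto. This is the source of all secrecy. -/
theorem exists_act_moore_eq [Finite K] {ι' : Type*} {m : ℕ} (E : Matrix ι' κ F) {a : κ → K}
    (ha : LinearIndependent F a) (hE : E.rank ≤ m) (hm : m ≤ Fintype.card κ) (x : κ → K) :
    ∃ t : Fin m → K, E.act (moore F a t) = E.act x := by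
  classical
  obtain ⟨C, E', hE', rfl⟩ : ∃ (C : Matrix ι' (Fin m) F) (E' : Matrix (Fin m) κ F),
      m ≤ E'.rank ∧ E = C * E' := E.exists_eq_mul_of_rank_le hE hm
  have hinj : Function.Injective fun t : Fin m → K => E'.act (moore F a t) :=
    fun t t' h => act_moore_injective E' ha hE' h
  obtain ⟨t, ht⟩ := Finite.surjective_of_injective hinj (E'.act x)
  refine ⟨t, ?_⟩
  rw [Matrix.act_mul, Matrix.act_mul]
  exact congrArg _ ht

end Moore

/-! ### Averaging over families of injections, and the union bound. -/

section Counting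

/-- If every orbit of a family of injective self-maps indexed by `R` meets `s` for at most `n`
indices, then the density of `s` is at most `n / |R|`. -/
theorem card_mul_ncard_le {Ω R : Type*} [Finite Ω] [Finite R] (T : R → Ω → Ω)
    (hT : ∀ ρ, Function.Injective (T ρ)) (s : Set Ω) (n : ℕ)
    (h : ∀ ω, {ρ | T ρ ω ∈ s}.ncard ≤ n) : Nat.card R * s.ncard ≤ n * Nat.card Ω := by
  classical
  have := Fintype.ofFinite Ω
  have := Fintype.ofFinite R
  have h1 : ∀ ρ, (Finset.univ.filter fun ω => T ρ ω ∈ s).card = s.ncard := by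
    intro ρ
    have hb : Function.Bijective (T ρ) := (Finite.injective_iff_bijective).mp (hT ρ)
    rw [← Set.ncard_preimage_of_injective_subset_range (hT ρ) (s := s)
      (by rw [hb.surjective.range_eq]; exact Set.subset_univ _), ← Set.ncard_coe_finset]
    congr 1
    ext ω
    simp
  have h2 := Finset.sum_card_bipartiteAbove_eq_sum_card_bipartiteBelow
    (s := (Finset.univ : Finset R)) (t := (Finset.univ : Finset Ω)) (fun ρ ω => T ρ ω ∈ s)
  simp only [Finset.bipartiteAbove, Finset.bipartiteBelow, h1] at h2
  rw [Finset.sum_const, smul_eq_mul, Finset.card_univ] at h2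
  rw [Nat.card_eq_fintype_card, Nat.card_eq_fintype_card, h2]
  calc _ ≤ ∑ _ω : Ω, n := Finset.sum_le_sum fun ω _ => by
        refine le_trans (le_of_eq ?_) (h ω)
        rw [← Set.ncard_coe_finset]
        congr 1
        ext ω
        simp
    _ = n * Fintype.card Ω := by simp [mul_comm]

theorem ncard_iUnion_le_card_mul {Ω I : Type*} [Finite Ω] [Finite I] (s : I → Set Ω) (c N : ℕ)
    (h : ∀ i, c * (s i).ncard ≤ N) : c * (⋃ i, s i).ncard ≤ Nat.card I * N := by
  classical
  have := Fintype.ofFinite I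
  have h1 : (⋃ i, s i).ncard ≤ ∑ i, (s i).ncard := Set.ncard_iUnion_le_of_fintype s
  calc c * (⋃ i, s i).ncard ≤ c * ∑ i, (s i).ncard := Nat.mul_le_mul_left _ h1
    _ = ∑ i, c * (s i).ncard := Finset.mul_sum _ _ _
    _ ≤ ∑ _i : I, N := Finset.sum_le_sum fun i _ => h i
    _ = Nat.card I * N := by simp

end Counting

/-! ### The polynomial hash. -/

section Hash

variable {F K : Type*} [Field F] [Field K] [Algebra F K]

/-- The value at `r` of the polynomial with coefficients `w`. -/
def polyHash {n : ℕ} (w : Fin n → F) (r : K) : K := ∑ i : Fin n, w i • r ^ (i : ℕ)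

theorem ncard_polyHash_eq_le [Finite K] {n : ℕ} {w w' : Fin n → F} (h : w ≠ w') :
    {r : K | polyHash w r = polyHash w' r}.ncard ≤ n := by
  classical
  let p : Polynomial F := ∑ i : Fin n, Polynomial.C (w i - w' i) * Polynomial.X ^ (i : ℕ)
  have hcoeff : ∀ i : Fin n, p.coeff i = w i - w' i := by
    intro i
    simp only [p, Polynomial.finsetSum_coeff, Polynomial.coeff_C_mul_X_pow]
    rw [Finset.sum_eq_single i]
    · simp
    · intro j _ hij
      rw [if_neg]
      intro h
      exact hij (Fin.ext h.symm)
    · simp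
  have hp : p ≠ 0 := by
    intro h0
    exact h (funext fun i => sub_eq_zero.mp (by rw [← hcoeff i, h0]; simp))
  have hp' : p.map (algebraMap F K) ≠ 0 := Polynomial.map_ne_zero hp
  have hdeg : p.natDegree ≤ n := by
    refine Polynomial.natDegree_sum_le_of_forall_le _ _ fun j _ => ?_
    exact (Polynomial.natDegree_C_mul_X_pow_le _ _).trans j.2.le
  have hsub : {r : K | polyHash w r = polyHash w' r} ⊆
      ((p.map (algebraMap F K)).roots.toFinset : Set K) := by
    intro r hr
    rw [Finset.mem_coe, Multiset.mem_toFinset, Polynomial.mem_roots hp']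
    have hr' := sub_eq_zero.mpr (show polyHash w r = polyHash w' r from hr)
    rw [polyHash, polyHash, ← Finset.sum_sub_distrib] at hr'
    simpa [p, Polynomial.IsRoot, Polynomial.eval_finsetSum, Polynomial.map_sum, sub_mul,
      Algebra.smul_def] using hr'
  calc _ ≤ _ := Set.ncard_le_ncard hsub (Finset.finite_toSet _)
    _ = (p.map (algebraMap F K)).roots.toFinset.card := Set.ncard_coe_finset _
    _ ≤ (p.map (algebraMap F K)).natDegree :=
        (Multiset.toFinset_card_le _).trans (Polynomial.card_roots' _)
    _ ≤ n := Polynomial.natDegree_map_le.trans hdeg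

end Hash

/-! ### The code over the extension fields. -/

/-- The ingredients of the code. The main block consists of vectors over `K₁`, the side blocks,
indexed by `J`, consist of vectors over `K₂`; the hash key and the hash value are encoded into
the bits `J → Prop`. -/
structure CodeData (F K₁ K₂ J : Type*) [Field F] [Field K₁] [Algebra F K₁] [Field K₂]
    [Algebra F K₂] (m2 d m3 n : ℕ) where
  a₁ : Fin m3 → K₁
  indep₁ : LinearIndependent F a₁
  a₂ : Fin m3 → K₂
  indep₂ : LinearIndependent F a₂
  label : K₂ × K₂ → (J → Prop)
  label_injective : Function.Injective label
  coord : (Fin (m2 + d) → K₁) → (Fin n → F)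
  coord_injective : Function.Injective coord

/-- The scramble variables: the padding of the main block, the hash key, the padding of the
side blocks, and the noise of the side blocks. -/
abbrev Scramble (K₁ K₂ J : Type*) (m2 m3 : ℕ) :=
  (Fin m2 → K₁) × K₂ × (J → Fin m2 → K₂) × (J → Fin m3 → K₂)

namespace CodeData

variable {F K₁ K₂ J : Type*} [Field F] [Fintype F] [Field K₁] [Algebra F K₁] [Field K₂]
  [Algebra F K₂] {m2 d m3 n : ℕ} (C : CodeData F K₁ K₂ J m2 d m3 n)

/-- The bits sent over the side blocks. -/
def bits (M : Fin d → K₁) (L : Fin m2 → K₁) (r : K₂) : J → Prop :=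
  C.label (r, polyHash (C.coord (Fin.append L M)) r)

open Classical in
/-- The noise on the side block `j`, present if its bit is set. -/
noncomputable def mask (M : Fin d → K₁) (σ : Scramble K₁ K₂ J m2 m3) (j : J) : Fin m3 → K₂ :=
  if C.bits M σ.1 σ.2.1 j then σ.2.2.2 j else 0

/-- The main block. -/
noncomputable def encMain (M : Fin d → K₁) (L : Fin m2 → K₁) : Fin m3 → K₁ :=
  moore F C.a₁ (Fin.append L M)

/-- The side block `j`. -/
noncomputable def encSide (M : Fin d → K₁) (σ : Scramble K₁ K₂ J m2 m3) (j : J) : Fin m3 → K₂ :=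
  moore F C.a₂ (σ.2.2.1 j) + C.mask M σ j

/-- The main block and the side blocks together. -/
noncomputable def encode (M : Fin d → K₁) (σ : Scramble K₁ K₂ J m2 m3) :
    Fin m3 → K₁ × (J → K₂) :=
  fun i => (C.encMain M σ.1 i, fun j => C.encSide M σ j i)

theorem act_encode_fst {ι : Type*} (E : Matrix ι (Fin m3) F) (M : Fin d → K₁)
    (σ : Scramble K₁ K₂ J m2 m3) (i : ι) :
    (E.act (C.encode M σ) i).1 = E.act (C.encMain M σ.1) i :=
  (E.act_comp (LinearMap.fst F K₁ (J → K₂)) _ i).symm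

theorem act_encode_snd {ι : Type*} (E : Matrix ι (Fin m3) F) (M : Fin d → K₁)
    (σ : Scramble K₁ K₂ J m2 m3) (i : ι) (j : J) :
    (E.act (C.encode M σ) i).2 j = E.act (C.encSide M σ j) i :=
  (E.act_comp (LinearMap.proj j ∘ₗ LinearMap.snd F K₁ (J → K₂)) _ i).symm

theorem act_encode_eq {ι : Type*} {E : Matrix ι (Fin m3) F} {M M' : Fin d → K₁}
    {σ σ' : Scramble K₁ K₂ J m2 m3} (h1 : E.act (C.encMain M σ.1) = E.act (C.encMain M' σ'.1))
    (h2 : ∀ j, E.act (C.encSide M σ j) = E.act (C.encSide M' σ' j)) :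
    E.act (C.encode M σ) = E.act (C.encode M' σ') := by
  ext i
  · rw [act_encode_fst, act_encode_fst, h1]
  · rw [act_encode_snd, act_encode_snd, h2]

/-! ### Changes that Eve cannot notice. -/

section Secrecy

variable {ι : Type*} {KE : Matrix ι (Fin m3) F}

/-- Change the message and the main padding and the key, and compensate the resulting change of
the side blocks by their paddings so that an eavesdropper does not notice it. -/
noncomputable def shift (δ : (Fin m3 → K₂) → (Fin m2 → K₂)) (M : Fin d → K₁)
    (σ : Scramble K₁ K₂ J m2 m3) (M' : Fin d → K₁) (L' : Fin m2 → K₁) (r' : K₂) :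
    Scramble K₁ K₂ J m2 m3 :=
  (L', r', fun j => σ.2.2.1 j + δ (C.mask M σ j - C.mask M' (L', r', σ.2.2) j), σ.2.2.2)

theorem act_encSide_shift {δ : (Fin m3 → K₂) → (Fin m2 → K₂)}
    (hδ : ∀ x, KE.act (moore F C.a₂ (δ x)) = KE.act x) (M : Fin d → K₁)
    (σ : Scramble K₁ K₂ J m2 m3) (M' : Fin d → K₁) (L' : Fin m2 → K₁) (r' : K₂) (j : J) :
    KE.act (C.encSide M' (C.shift δ M σ M' L' r') j) = KE.act (C.encSide M σ j) := by
  have hmask : C.mask M' (C.shift δ M σ M' L' r') j = C.mask M' (L', r', σ.2.2) j := rfl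
  rw [encSide, encSide, hmask]
  simp only [shift, moore_add, map_add, hδ, map_sub]
  abel

/-- The map is triangular: the correction of the side paddings depends on the other coordinates
only, and these are recovered first. -/
theorem shift_injective {δ : (Fin m3 → K₂) → (Fin m2 → K₂)} {M M' : Fin d → K₁}
    {L' : (Fin m2 → K₁) → (Fin m2 → K₁)} (hL : Function.Injective L') {r' : K₂ → K₂}
    (hr : Function.Injective r') :
    Function.Injective fun σ => C.shift δ M σ M' (L' σ.1) (r' σ.2.1) := by
  rintro ⟨L₁, r₁, t₁, s₁⟩ ⟨L₂, r₂, t₂, s₂⟩ h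
  simp only [shift, Prod.mk.injEq] at h
  obtain ⟨h1, h2, h3, h4⟩ := h
  obtain rfl := hL h1
  obtain rfl := hr h2
  subst h4
  have : t₁ = t₂ := by
    funext j
    exact add_right_cancel (congrFun h3 j)
  rw [this]

theorem exists_scramble_map [Finite K₁] [Finite K₂] (hKE : KE.rank ≤ m2) (hm : m2 ≤ m3) (M M' : Fin d → K₁) :
    ∃ T : Scramble K₁ K₂ J m2 m3 → Scramble K₁ K₂ J m2 m3, Function.Injective T ∧
      ∀ σ, KE.act (C.encode M' (T σ)) = KE.act (C.encode M σ) := by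
  have hm' : m2 ≤ Fintype.card (Fin m3) := by simpa using hm
  choose δ₂ hδ₂ using exists_act_moore_eq KE C.indep₂ hKE hm'
  obtain ⟨η, hη⟩ := exists_act_moore_eq KE C.indep₁ hKE hm'
    (moore F C.a₁ (Fin.append (0 : Fin m2 → K₁) M) -
      moore F C.a₁ (Fin.append (0 : Fin m2 → K₁) M'))
  refine ⟨fun σ => C.shift δ₂ M σ M' (σ.1 + η) σ.2.1,
    C.shift_injective (L' := fun L => L + η) (add_left_injective η) (r' := id)
      Function.injective_id, fun σ => ?_⟩
  refine C.act_encode_eq ?_ fun j => C.act_encSide_shift hδ₂ M σ M' _ _ j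
  simp only [encMain, shift]
  rw [moore_append, moore_append C.a₁ σ.1, moore_add]
  simp only [map_add, hη, map_sub]
  abel

end Secrecy

/-! ### Bob's decoder and its failure events. -/

section Decoding

/-- What Bob tests for: a pair `(E, B)` is admissible if it may arise as `E H = 0`, `B = E K`
from a network with `rank H ≤ m1` and `rank K = m1 + D`. -/
abbrev Guess (F : Type*) [Field F] (m1 m3 m4 D : ℕ) :=
  {p : Matrix (Fin m4) (Fin m4) F × Matrix (Fin m4) (Fin m3) F //
    m4 ≤ p.1.rank + m1 ∧ D ≤ p.2.rank}

/-- The main block that Bob receives. -/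
def recMain {m4 : ℕ} (Y : Fin m4 → K₁ × (J → K₂)) : Fin m4 → K₁ := fun i => (Y i).1

/-- The side block `j` that Bob receives. -/
def recSide {m4 : ℕ} (Y : Fin m4 → K₁ × (J → K₂)) (j : J) : Fin m4 → K₂ := fun i => (Y i).2 j

/-- The received word is consistent with the message, the main padding and the key. -/
def Consistent (m1 : ℕ) {m4 : ℕ} (Y : Fin m4 → K₁ × (J → K₂)) (M : Fin d → K₁)
    (L : Fin m2 → K₁) (r : K₂) : Prop :=
  (∀ j, C.bits M L r j ↔ ¬ ∃ (g : Guess F m1 m3 m4 (m2 + d)) (t : Fin m2 → K₂),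
    g.1.1.act (recSide Y j) = g.1.2.act (moore F C.a₂ t)) ∧
  ∃ g : Guess F m1 m3 m4 (m2 + d), g.1.1.act (recMain Y) = g.1.2.act (C.encMain M L)

/-- Some message with which the received word is consistent. -/
noncomputable def decode (m1 : ℕ) {m4 : ℕ} (Y : Fin m4 → K₁ × (J → K₂)) : Fin d → K₁ :=
  Classical.epsilon fun M => ∃ L r, C.Consistent m1 Y M L r

variable {m1 m4 m5 m6 : ℕ} (N : LinearNetwork F m3 m4 m5 m6)

/-- Bob's observation if Eve injects `z`. -/
noncomputable def received (M : Fin d → K₁) (σ : Scramble K₁ K₂ J m2 m3)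
    (z : Fin m5 → K₁ × (J → K₂)) : Fin m4 → K₁ × (J → K₂) :=
  N.KB.act (C.encode M σ) + N.HB.act z

theorem recMain_received (M : Fin d → K₁) (σ : Scramble K₁ K₂ J m2 m3)
    (z : Fin m5 → K₁ × (J → K₂)) :
    recMain (C.received N M σ z) =
      N.KB.act (C.encMain M σ.1) + N.HB.act fun i => (z i).1 := by
  ext i
  simp only [recMain, received, Pi.add_apply, Prod.fst_add, act_encode_fst]
  congr 1
  exact (N.HB.act_comp (LinearMap.fst F K₁ (J → K₂)) z i).symm

theorem recSide_received (M : Fin d → K₁) (σ : Scramble K₁ K₂ J m2 m3)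
    (z : Fin m5 → K₁ × (J → K₂)) (j : J) :
    recSide (C.received N M σ z) j =
      N.KB.act (C.encSide M σ j) + N.HB.act fun i => (z i).2 j := by
  ext i
  simp only [recSide, received, Pi.add_apply, Prod.snd_add, act_encode_snd]
  congr 1
  exact (N.HB.act_comp (LinearMap.proj j ∘ₗ LinearMap.snd F K₁ (J → K₂)) z i).symm

/-- The bit of the side block `j` is set, but the received block looks as if it were not. -/
def SideFailure (g : Guess F m1 m3 m4 (m2 + d)) (j : J) (M : Fin d → K₁)
    (σ : Scramble K₁ K₂ J m2 m3) (Y : Fin m4 → K₁ × (J → K₂)) : Prop :=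
  C.bits M σ.1 σ.2.1 j ∧ ∃ t : Fin m2 → K₂,
    g.1.1.act (recSide Y j) = g.1.2.act (moore F C.a₂ t)

/-- A wrong explanation of the main block has the right hash value. -/
def HashFailure (g : Guess F m1 m3 m4 (m2 + d)) (M : Fin d → K₁)
    (σ : Scramble K₁ K₂ J m2 m3) (Y : Fin m4 → K₁ × (J → K₂)) : Prop :=
  ∃ W : Fin (m2 + d) → K₁, W ≠ Fin.append σ.1 M ∧
    g.1.1.act (recMain Y) = g.1.2.act (moore F C.a₁ W) ∧
    polyHash (C.coord W) σ.2.1 = polyHash (C.coord (Fin.append σ.1 M)) σ.2.1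

/-- The guess that corresponds to the network itself. -/
theorem exists_guess {F : Type*} [Field F] {m1 m3 m4 m5 m6 D : ℕ} (N : LinearNetwork F m3 m4 m5 m6)
    (hKB : N.KB.rank = m1 + D) (hHB : N.HB.rank ≤ m1) :
    ∃ g : Guess F m1 m3 m4 D, g.1.1 * N.HB = 0 ∧ g.1.2 = g.1.1 * N.KB := by
  obtain ⟨E, hE, hrk⟩ := N.HB.exists_left_annihilator
  have h := E.rank_add_rank_le_rank_mul N.KB
  rw [Fintype.card_fin] at hrk h
  exact ⟨⟨(E, E * N.KB), by dsimp only; omega, by dsimp only; omega⟩, hE, rfl⟩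

/-- Without side failures the received word determines all bits, so every consistent candidate has
the true key and hash value. Without hash failures its main block is then the true one. -/
theorem decode_received (hKB : N.KB.rank = m1 + (m2 + d)) (hHB : N.HB.rank ≤ m1)
    (M : Fin d → K₁) (σ : Scramble K₁ K₂ J m2 m3) (z : Fin m5 → K₁ × (J → K₂))
    (hside : ∀ (g : Guess F m1 m3 m4 (m2 + d)) (j : J),
      ¬ C.SideFailure g j M σ (C.received N M σ z))
    (hhash : ∀ g : Guess F m1 m3 m4 (m2 + d), ¬ C.HashFailure g M σ (C.received N M σ z)) :
    C.decode m1 (C.received N M σ z) = M := by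
  obtain ⟨g₀, hg₀, hg₀'⟩ := exists_guess N hKB hHB
  set Y := C.received N M σ z with hY
  have htrue : C.Consistent m1 Y M σ.1 σ.2.1 := by
    refine ⟨fun j => ⟨?_, ?_⟩, g₀, ?_⟩
    · rintro hb ⟨g, t, ht⟩
      exact hside g j ⟨hb, t, ht⟩
    · intro hn
      by_contra hb
      refine hn ⟨g₀, σ.2.2.1 j, ?_⟩
      rw [hY, recSide_received, map_add, ← Matrix.act_mul, ← Matrix.act_mul, hg₀, ← hg₀',
        Matrix.act_zero_left, add_zero, encSide, mask, if_neg hb, add_zero]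
    · rw [hY, recMain_received, map_add, ← Matrix.act_mul, ← Matrix.act_mul, hg₀, ← hg₀',
        Matrix.act_zero_left, add_zero]
  obtain ⟨L, r, hbits, g, hg⟩ :=
    Classical.epsilon_spec (p := fun M => ∃ L r, C.Consistent m1 Y M L r) ⟨M, _, _, htrue⟩
  change (∀ j, C.bits (C.decode m1 Y) L r j ↔ _) at hbits
  change g.1.1.act (recMain Y) = g.1.2.act (moore F C.a₁ (Fin.append L (C.decode m1 Y))) at hg
  have heq : C.bits (C.decode m1 Y) L r = C.bits M σ.1 σ.2.1 :=
    funext fun j => propext ((hbits j).trans (htrue.1 j).symm)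
  have hlab := C.label_injective heq
  rw [Prod.mk.injEq] at hlab
  obtain ⟨rfl, hh⟩ := hlab
  have hW : Fin.append L (C.decode m1 Y) = Fin.append σ.1 M := by
    by_contra hne
    exact hhash g ⟨_, hne, hg, hh⟩
  funext i
  have := congrFun hW (Fin.natAdd m2 i)
  simpa using this

variable [Finite K₁] [Finite K₂] [Finite J]

theorem sideFailure_le (hd : 0 < d) (hKB : N.KB.rank = m1 + (m2 + d)) (hKE : N.KE.rank ≤ m2)
    (z : (Fin d → K₁) × Scramble K₁ K₂ J m2 m3 → Fin m5 → K₁ × (J → K₂))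
    (hz : ∀ ω ω', N.KE.act (C.encode ω.1 ω.2) = N.KE.act (C.encode ω'.1 ω'.2) → z ω = z ω')
    (g : Guess F m1 m3 m4 (m2 + d)) (j : J) :
    Nat.card K₂ * {ω | C.SideFailure g j ω.1 ω.2 (C.received N ω.1 ω.2 (z ω))}.ncard ≤
      1 * Nat.card ((Fin d → K₁) × Scramble K₁ K₂ J m2 m3) := by
  classical
  have hrk : N.KE.rank < (g.1.1 * N.KB).rank := by
    have h := g.1.1.rank_add_rank_le_rank_mul N.KB
    have := g.2.1
    rw [Fintype.card_fin] at h
    omega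
  -- A direction that Eve cannot see and that survives the guessed projection; here `d > 0` is used.
  obtain ⟨ν, hν, hν'⟩ := N.KE.exists_mulVec_eq_zero_of_rank_lt _ hrk
  obtain ⟨i, hi⟩ := Function.ne_iff.mp hν'
  -- Translate the noise of block `j` along `ν`. Neither the bits nor Eve's view change, so her
  -- injection stays fixed.
  let T : K₂ → (Fin d → K₁) × Scramble K₁ K₂ J m2 m3 → (Fin d → K₁) × Scramble K₁ K₂ J m2 m3 :=
    fun ρ ω => (ω.1, ω.2.1, ω.2.2.1, ω.2.2.2.1, ω.2.2.2.2 + Pi.single j fun k => ν k • ρ)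
  have hbits : ∀ ρ ω, C.bits (T ρ ω).1 (T ρ ω).2.1 (T ρ ω).2.2.1 =
    C.bits ω.1 ω.2.1 ω.2.2.1 := fun _ _ => rfl
  refine card_mul_ncard_le T ?_ _ 1 fun ω => ?_
  · rintro ρ ⟨M, L, r, t, s⟩ ⟨M', L', r', t', s'⟩ h
    simpa [T] using h
  rw [Set.ncard_le_one_iff]
  rintro ρ ρ' ⟨hb, t, ht⟩ ⟨-, t', ht'⟩
  rw [hbits] at hb
  have hside : ∀ ρ, C.encSide (T ρ ω).1 (T ρ ω).2 j =
      C.encSide ω.1 ω.2 j + fun k => ν k • ρ := by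
    intro ρ
    rw [encSide, encSide, mask, mask, if_pos (by rw [hbits]; exact hb), if_pos hb]
    simp [T, add_assoc]
  have hsee : ∀ ρ, z (T ρ ω) = z ω := by
    intro ρ
    refine hz _ _ (C.act_encode_eq rfl fun j' => ?_)
    by_cases hj : j' = j
    · subst hj
      rw [hside, map_add, add_eq_left]
      ext k
      rw [Matrix.act_smul_right, hν]
      simp
    · congr 1
      rw [encSide, encSide, mask, mask, hbits]
      simp [T, Pi.single_eq_of_ne hj]
  rw [recSide_received, hsee, hside] at ht ht'
  -- Subtracting two failures cancels the injection, even though the guess need not annihilate `HB`.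
  have key : ∀ k, g.1.2.act (moore F C.a₂ (t - t')) k =
      ((g.1.1 * N.KB).mulVec ν) k • (ρ - ρ') := by
    intro k
    rw [moore_sub, map_sub, ← ht, ← ht', ← map_sub, add_sub_add_right_eq_sub, ← map_sub,
      add_sub_add_left_eq_sub, ← Matrix.act_mul, map_sub, Pi.sub_apply, Matrix.act_smul_right,
      Matrix.act_smul_right, smul_sub]
  have h0 := eq_zero_of_act_moore_eq_smul g.1.2 C.indep₂
    (lt_of_lt_of_le (by omega) g.2.2) key i
  exact sub_eq_zero.mp ((smul_eq_zero.mp h0).resolve_left hi)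

theorem hashFailure_le (hm : m2 ≤ m3) (hKE : N.KE.rank ≤ m2)
    (z : (Fin d → K₁) × Scramble K₁ K₂ J m2 m3 → Fin m5 → K₁ × (J → K₂))
    (hz : ∀ ω ω', N.KE.act (C.encode ω.1 ω.2) = N.KE.act (C.encode ω'.1 ω'.2) → z ω = z ω')
    (g : Guess F m1 m3 m4 (m2 + d)) :
    Nat.card K₂ * {ω | C.HashFailure g ω.1 ω.2 (C.received N ω.1 ω.2 (z ω))}.ncard ≤
      n * Nat.card ((Fin d → K₁) × Scramble K₁ K₂ J m2 m3) := by
  choose δ hδ using exists_act_moore_eq N.KE C.indep₂ hKE (by simpa using hm)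
  -- Vary only the key; the side paddings absorb the effect on the bits, so Eve's injection and the
  -- received main block stay fixed.
  let T : K₂ → (Fin d → K₁) × Scramble K₁ K₂ J m2 m3 → (Fin d → K₁) × Scramble K₁ K₂ J m2 m3 :=
    fun ρ ω => (ω.1, C.shift δ ω.1 ω.2 ω.1 ω.2.1 (ω.2.2.1 + ρ))
  refine card_mul_ncard_le T ?_ _ n fun ω => ?_
  · rintro ρ ⟨M, σ⟩ ⟨M', σ'⟩ h
    obtain ⟨rfl, h⟩ := Prod.mk.inj h
    exact congrArg (Prod.mk M) (C.shift_injective (M := M) (M' := M) (L' := id)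
      Function.injective_id (r' := fun r => r + ρ) (add_left_injective ρ) h)
  have hsee : ∀ ρ, z (T ρ ω) = z ω := fun ρ =>
    hz _ _ (C.act_encode_eq rfl fun j => C.act_encSide_shift hδ _ _ _ _ _ j)
  have hmain : ∀ ρ, recMain (C.received N (T ρ ω).1 (T ρ ω).2 (z (T ρ ω))) =
      recMain (C.received N ω.1 ω.2 (z ω)) := by
    intro ρ
    rw [recMain_received, recMain_received, hsee]
    rfl
  rcases Set.eq_empty_or_nonempty {ρ | T ρ ω ∈
    {ω | C.HashFailure g ω.1 ω.2 (C.received N ω.1 ω.2 (z ω))}} with he | ⟨ρ₀, W, hW, hg, -⟩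
  · rw [he]
    simp
  rw [hmain] at hg
  change W ≠ Fin.append ω.2.1 ω.1 at hW
  refine le_trans ?_ (ncard_polyHash_eq_le (K := K₂) (C.coord_injective.ne hW))
  refine Set.ncard_le_ncard_of_injOn (fun ρ => ω.2.2.1 + ρ) ?_
    (add_right_injective ω.2.2.1).injOn (Set.toFinite _)
  rintro ρ ⟨W', -, hg', hh⟩
  rw [hmain] at hg'
  -- The guess admits a single `W`, so all failing keys are collisions of one fixed pair.
  obtain rfl : W = W' := act_moore_injective g.1.2 C.indep₁ g.2.2 (hg.symm.trans hg')
  exact hh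

theorem card_mul_ncard_decode_ne_le (hd : 0 < d) (hm : m2 ≤ m3)
    (hKB : N.KB.rank = m1 + (m2 + d)) (hHB : N.HB.rank ≤ m1) (hKE : N.KE.rank ≤ m2)
    (z : (Fin d → K₁) × Scramble K₁ K₂ J m2 m3 → Fin m5 → K₁ × (J → K₂))
    (hz : ∀ ω ω', N.KE.act (C.encode ω.1 ω.2) = N.KE.act (C.encode ω'.1 ω'.2) → z ω = z ω') :
    Nat.card K₂ * {ω | C.decode m1 (C.received N ω.1 ω.2 (z ω)) ≠ ω.1}.ncard ≤
      Nat.card (Guess F m1 m3 m4 (m2 + d)) * (Nat.card J + n) *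
        Nat.card ((Fin d → K₁) × Scramble K₁ K₂ J m2 m3) := by
  set R := Nat.card ((Fin d → K₁) × Scramble K₁ K₂ J m2 m3)
  let A : Guess F m1 m3 m4 (m2 + d) → Set ((Fin d → K₁) × Scramble K₁ K₂ J m2 m3) := fun g =>
    (⋃ j, {ω | C.SideFailure g j ω.1 ω.2 (C.received N ω.1 ω.2 (z ω))}) ∪
      {ω | C.HashFailure g ω.1 ω.2 (C.received N ω.1 ω.2 (z ω))}
  have hsub : {ω | C.decode m1 (C.received N ω.1 ω.2 (z ω)) ≠ ω.1} ⊆ ⋃ g, A g := by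
    intro ω hω
    by_contra hn
    simp only [A, Set.mem_iUnion, Set.mem_union, Set.mem_ofPred_eq, not_exists, not_or] at hn
    exact hω (C.decode_received N hKB hHB ω.1 ω.2 (z ω) (fun g => (hn g).1) fun g => (hn g).2)
  have hA : ∀ g, Nat.card K₂ * (A g).ncard ≤ (Nat.card J + n) * R := by
    intro g
    have h1 := ncard_iUnion_le_card_mul _ _ _
      fun j => C.sideFailure_le N hd hKB hKE z hz g j
    have h2 := C.hashFailure_le N hm hKE z hz g
    have h3 : (A g).ncard ≤ _ := Set.ncard_union_le _ _
    calc _ ≤ Nat.card K₂ * (_ + _) := Nat.mul_le_mul_left _ h3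
      _ ≤ Nat.card J * (1 * R) + n * R := by
        rw [mul_add]
        exact add_le_add h1 h2
      _ = _ := by ring
  calc _ ≤ Nat.card K₂ * (⋃ g, A g).ncard :=
        Nat.mul_le_mul_left _ (Set.ncard_le_ncard hsub (Set.toFinite _))
    _ ≤ _ := ncard_iUnion_le_card_mul _ _ _ hA
    _ = _ := by ring

end Decoding

end CodeData

/-! ### Uniform probabilities and vanishing mutual information. -/

section UniformProb

theorem uniformProb_eq_ncard {Ω : Type*} [Finite Ω] (p : Ω → Prop) :
    uniformProb p = ({ω | p ω}.ncard : ℝ) / (Nat.card Ω : ℝ) := rfl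

theorem uniformProb_comp_equiv {Ω Ω' : Type*} [Finite Ω] [Finite Ω'] (e : Ω ≃ Ω') (p : Ω' → Prop) :
    uniformProb (fun ω => p (e ω)) = uniformProb p := by
  rw [uniformProb, uniformProb, Nat.card_congr e,
    Nat.card_congr (e.subtypeEquiv (p := fun ω => p (e ω)) (q := p) fun _ => Iff.rfl)]

theorem mutualInformation_eq_zero_of_indep {Ω A B : Type*} [Finite Ω] [Finite A] [Finite B]
    (U : Ω → A) (V : Ω → B)
    (h : ∀ a b, uniformProb (fun ω => U ω = a ∧ V ω = b) =
      uniformProb (fun ω => U ω = a) * uniformProb (fun ω => V ω = b)) :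
    mutualInformation U V = 0 := by
  rw [mutualInformation]
  refine finsum_eq_zero_of_forall_eq_zero fun a => finsum_eq_zero_of_forall_eq_zero fun b => ?_
  rw [h a b]
  rcases eq_or_ne (uniformProb (fun ω => U ω = a) * uniformProb fun ω => V ω = b) 0 with h0 | h0
  · rw [h0, zero_mul]
  · rw [div_self h0, Real.log_one, mul_zero]

/-- Injections in both directions make the number of scrambles producing a given output the same for
all messages, which is independence. -/
theorem mutualInformation_fst_eq_zero {A S B : Type*} [Finite A] [Finite S] [Finite B]
    (g : A × S → B)
    (h : ∀ a a', ∃ T : S → S, Function.Injective T ∧ ∀ σ, g (a', T σ) = g (a, σ)) :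
    mutualInformation (fun ω : A × S => ω.1) g = 0 := by
  refine mutualInformation_eq_zero_of_indep _ _ fun a b => ?_
  have hle : ∀ a a', Nat.card {σ // g (a, σ) = b} ≤ Nat.card {σ // g (a', σ) = b} := by
    intro a a'
    obtain ⟨T, hT, hg⟩ := h a a'
    exact Nat.card_le_card_of_injective
      (fun σ => (⟨T σ.1, (hg σ.1).trans σ.2⟩ : {σ // g (a', σ) = b}))
      fun σ σ' hσ => Subtype.ext (hT (congrArg Subtype.val hσ))
  have hc : ∀ a', Nat.card {σ // g (a', σ) = b} = Nat.card {σ // g (a, σ) = b} :=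
    fun a' => le_antisymm (hle _ _) (hle _ _)
  have e1 : Nat.card {ω : A × S // ω.1 = a ∧ g ω = b} = Nat.card {σ // g (a, σ) = b} := by
    refine Nat.card_congr ⟨fun ω => ⟨ω.1.2, ?_⟩, fun σ => ⟨(a, σ.1), rfl, σ.2⟩, ?_, fun _ => rfl⟩
    · obtain ⟨⟨x, y⟩, rfl, h2⟩ := ω
      exact h2
    · rintro ⟨⟨x, y⟩, rfl, h2⟩
      rfl
  have e2 : Nat.card {ω : A × S // ω.1 = a} = Nat.card S := by
    refine Nat.card_congr ⟨fun ω => ω.1.2, fun σ => ⟨(a, σ), rfl⟩, ?_, fun _ => rfl⟩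
    rintro ⟨⟨x, y⟩, rfl⟩
    rfl
  have e3 : Nat.card {ω : A × S // g ω = b} = Nat.card A * Nat.card {σ // g (a, σ) = b} := by
    have : Nat.card {ω : A × S // g ω = b} = Nat.card (Σ a', {σ // g (a', σ) = b}) :=
      Nat.card_congr ⟨fun ω => ⟨ω.1.1, ω.1.2, ω.2⟩, fun x => ⟨(x.1, x.2.1), x.2.2⟩,
        fun _ => rfl, fun _ => rfl⟩
    have := Fintype.ofFinite A
    rw [‹Nat.card _ = Nat.card (Σ a', _)›, Nat.card_sigma, Finset.sum_congr rfl fun a' _ => hc a']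
    simp
  simp only [uniformProb, e1, e2, e3, Nat.card_prod]
  push_cast
  rcases isEmpty_or_nonempty S with hS | hS
  · simp
  have hA : (Nat.card A : ℝ) ≠ 0 := by
    have : Nonempty A := ⟨a⟩
    exact_mod_cast Nat.card_pos.ne'
  have hS' : (Nat.card S : ℝ) ≠ 0 := by exact_mod_cast Nat.card_pos.ne'
  field_simp

end UniformProb

/-! ### From blocks over extension fields to matrices over F. -/

theorem eveOutput_eq_iff {F : Type*} [Field F] {m3 m4 m5 m6 n : ℕ}
    (N : LinearNetwork F m3 m4 m5 m6) (α : Strategy F m5 m6 n) (hα : UniquenessCondition N α)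
    (X : Matrix (Fin m3) (Fin n) F) (Y : Matrix (Fin m6) (Fin n) F) :
    eveOutput N α hα X = Y ↔ Y = N.KE * X + N.HE * α Y := by
  have h := (hα X).exists.choose_spec
  refine ⟨?_, fun hY => (hα X).unique h hY⟩
  rintro rfl
  exact h

/-- The fixed-point equation involves the input only through `N.KE * X`, and its solution is unique.
-/
theorem eveOutput_eq_of_mul_eq {F : Type*} [Field F] {m3 m4 m5 m6 n : ℕ}
    (N : LinearNetwork F m3 m4 m5 m6) (α : Strategy F m5 m6 n) (hα : UniquenessCondition N α)
    {X X' : Matrix (Fin m3) (Fin n) F} (h : N.KE * X = N.KE * X') :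
    eveOutput N α hα X = eveOutput N α hα X' := by
  rw [eveOutput_eq_iff, h]
  exact (eveOutput_eq_iff N α hα X' _).mp rfl

theorem Matrix.mul_of_linearEquiv {F V ι κ : Type*} [Field F] [Fintype κ] [AddCommGroup V]
    [Module F V] {n : ℕ} (φ : V ≃ₗ[F] (Fin n → F)) (E : Matrix ι κ F) (x : κ → V) :
    (E * Matrix.of fun k => φ (x k)) = Matrix.of fun i => φ (E.act x i) := by
  ext i t
  rw [Matrix.mul_apply, Matrix.of_apply, Matrix.act_apply, map_sum, Finset.sum_apply]
  simp

namespace CodeData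

variable {F K₁ K₂ J : Type*} [Field F] [Fintype F] [Field K₁] [Algebra F K₁] [Field K₂]
  [Algebra F K₂] {m2 d m3 n : ℕ} (C : CodeData F K₁ K₂ J m2 d m3 n)
  [Finite K₁] [Finite K₂] [Finite J] {l k : ℕ} (m1 m4 : ℕ)
  (φ : (K₁ × (J → K₂)) ≃ₗ[F] (Fin l → F)) (μ : (Fin k → F) ≃ (Fin d → K₁))

/-- The code over `F`, in coordinates. -/
noncomputable def toCode : NonLocalCode F m3 m4 l k where
  s := Nat.card (Scramble K₁ K₂ J m2 m3)
  s_pos := Nat.card_pos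
  enc M i := Matrix.of fun a => φ (C.encode (μ M) ((Finite.equivFin _).symm i) a)
  dec Y := μ.symm (C.decode m1 fun i => φ.symm (Y i))

variable {m5 m6 : ℕ} (N : LinearNetwork F m3 m4 m5 m6) (α : Strategy F m5 m6 l)
  (hα : UniquenessCondition N α)

theorem leakedInformation_toCode (hm : m2 ≤ m3) (hKE : N.KE.rank ≤ m2) :
    leakedInformation (C.toCode m1 m4 φ μ) N α hα = 0 := by
  refine mutualInformation_fst_eq_zero _ fun M M' => ?_
  obtain ⟨T, hT, h⟩ := C.exists_scramble_map hKE hm (μ M) (μ M')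
  let e := Finite.equivFin (Scramble K₁ K₂ J m2 m3)
  refine ⟨fun i => e (T (e.symm i)), e.injective.comp (hT.comp e.symm.injective), fun i => ?_⟩
  refine eveOutput_eq_of_mul_eq N α hα ?_
  simp only [toCode]
  rw [Matrix.mul_of_linearEquiv, Matrix.mul_of_linearEquiv]
  change (Matrix.of fun j => φ (N.KE.act (C.encode (μ M') (e.symm (e (T (e.symm i))))) j)) = _
  rw [e.symm_apply_apply, h]

theorem errorProb_toCode_le (hd : 0 < d) (hm : m2 ≤ m3)
    (hKB : N.KB.rank = m1 + (m2 + d)) (hHB : N.HB.rank ≤ m1) (hKE : N.KE.rank ≤ m2) :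
    errorProb (C.toCode m1 m4 φ μ) N α hα ≤
      (Nat.card (Guess F m1 m3 m4 (m2 + d)) * (Nat.card J + n) : ℝ) / Nat.card K₂ := by
  let X : (Fin d → K₁) × Scramble K₁ K₂ J m2 m3 → Matrix (Fin m3) (Fin l) F :=
    fun ω => Matrix.of fun a => φ (C.encode ω.1 ω.2 a)
  let z : (Fin d → K₁) × Scramble K₁ K₂ J m2 m3 → Fin m5 → K₁ × (J → K₂) :=
    fun ω i => φ.symm (α (eveOutput N α hα (X ω)) i)
  have hz : ∀ ω ω', N.KE.act (C.encode ω.1 ω.2) = N.KE.act (C.encode ω'.1 ω'.2) →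
      z ω = z ω' := by
    intro ω ω' h
    have : eveOutput N α hα (X ω) = eveOutput N α hα (X ω') := by
      refine eveOutput_eq_of_mul_eq N α hα ?_
      simp only [X]
      rw [Matrix.mul_of_linearEquiv, Matrix.mul_of_linearEquiv, h]
    simp only [z, this]
  have hbob : ∀ ω, (fun i => φ.symm (bobOutput N α hα (X ω) i)) =
      C.received N ω.1 ω.2 (z ω) := by
    intro ω
    have h1 : α (eveOutput N α hα (X ω)) = Matrix.of fun i => φ (z ω i) := by
      ext i t
      simp [z]
    have h2 : N.KB * X ω = Matrix.of fun i => φ (N.KB.act (C.encode ω.1 ω.2) i) :=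
      Matrix.mul_of_linearEquiv φ _ _
    rw [bobOutput, h1, h2, Matrix.mul_of_linearEquiv]
    funext i
    change φ.symm (φ (N.KB.act (C.encode ω.1 ω.2) i) + φ (N.HB.act (z ω) i)) = _
    rw [← map_add, φ.symm_apply_apply]
    rfl
  have key := C.card_mul_ncard_decode_ne_le N hd hm hKB hHB hKE z hz
  have hprob : errorProb (C.toCode m1 m4 φ μ) N α hα =
      uniformProb fun ω : (Fin d → K₁) × Scramble K₁ K₂ J m2 m3 =>
        C.decode m1 (C.received N ω.1 ω.2 (z ω)) ≠ ω.1 := by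
    rw [← uniformProb_comp_equiv (Equiv.prodCongr μ (Finite.equivFin _).symm)]
    rw [errorProb]
    congr 1
    funext ω
    rw [← hbob]
    simp only [toCode, ne_eq, Equiv.symm_apply_eq]
    rfl
  rw [hprob, uniformProb_eq_ncard, div_le_div_iff₀]
  · rw [mul_comm]
    exact_mod_cast key
  · exact_mod_cast Nat.card_pos
  · exact_mod_cast Nat.card_pos

end CodeData

/-! ### Choice of parameters and asymptotics. -/

theorem exists_extension_field (F : Type*) [Field F] [Finite F] (b : ℕ) (hb : 0 < b) :
    ∃ (K : Type) (_ : Field K) (_ : Algebra F K), Finite K ∧ Module.finrank F K = b := by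
  obtain ⟨p, hp⟩ := CharP.exists F
  have : Fact p.Prime := ⟨CharP.char_is_prime F p⟩
  have : NeZero b := ⟨hb.ne'⟩
  exact ⟨FiniteField.Extension F p b, inferInstance, inferInstance, inferInstance,
    FiniteField.finrank_extension F p b⟩

theorem exists_linearIndependent_fin (F K : Type*) [Field F] [AddCommGroup K] [Module F K]
    {m : ℕ} (h : m ≤ Module.finrank F K) : ∃ a : Fin m → K, LinearIndependent F a :=
  exists_linearIndependent_of_le_finrank h

theorem exists_code (F : Type*) [Field F] [Fintype F] (m1 m2 d m3 m4 b : ℕ) (hd : 0 < d)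
    (hb : 0 < b) (hbm : m3 ≤ b) :
    ∃ Φ : NonLocalCode F m3 m4 (b ^ 3 + 2 * b * Fintype.card F * b) (d * b ^ 3),
      ∀ (m5 m6 : ℕ) (N : LinearNetwork F m3 m4 m5 m6),
        N.KB.rank = m1 + (m2 + d) → N.HB.rank ≤ m1 → N.KE.rank ≤ m2 →
        ∀ (α : Strategy F m5 m6 (b ^ 3 + 2 * b * Fintype.card F * b))
          (hα : UniquenessCondition N α),
          errorProb Φ N α hα ≤ (Nat.card (CodeData.Guess F m1 m3 m4 (m2 + d)) *
            ((2 * b * Fintype.card F : ℕ) + ((m2 + d) * b ^ 3 : ℕ)) : ℝ) /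
              (Fintype.card F ^ b : ℕ) ∧
          leakedInformation Φ N α hα = 0 := by
  classical
  have hb3 : b ≤ b ^ 3 := Nat.le_self_pow (by norm_num) b
  obtain ⟨K₁, _, _, _, h₁⟩ := exists_extension_field F (b ^ 3) (by positivity)
  obtain ⟨K₂, _, _, _, h₂⟩ := exists_extension_field F b hb
  obtain ⟨a₁, ha₁⟩ := exists_linearIndependent_fin F K₁ (m := m3) (by omega)
  obtain ⟨a₂, ha₂⟩ := exists_linearIndependent_fin F K₂ (m := m3) (by omega)
  have hcard : Nat.card K₂ = Fintype.card F ^ b := by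
    rw [Module.natCard_eq_pow_finrank (K := F), h₂, Nat.card_eq_fintype_card]
  obtain ⟨label⟩ : Nonempty (K₂ × K₂ ↪ (Fin (2 * b * Fintype.card F) → Prop)) := by
    have := Fintype.ofFinite K₂
    apply Function.Embedding.nonempty_of_card_le
    rw [Fintype.card_prod, ← Nat.card_eq_fintype_card, hcard, Fintype.card_fun, Fintype.card_fin,
      Fintype.card_prop, ← pow_add, ← two_mul, mul_comm (2 * b) (Fintype.card F),
      pow_mul 2 (Fintype.card F)]
    -- From q ≤ 2^q: the q^(2b) pairs of key and hash value fit into 2bq bits.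
    exact Nat.pow_le_pow_left Nat.lt_two_pow_self.le _
  let coord : (Fin (m2 + d) → K₁) ≃ₗ[F] (Fin ((m2 + d) * b ^ 3) → F) :=
    LinearEquiv.ofFinrankEq _ _ (by simp [Module.finrank_pi_fintype, h₁])
  let φ : (K₁ × (Fin (2 * b * Fintype.card F) → K₂)) ≃ₗ[F]
      (Fin (b ^ 3 + 2 * b * Fintype.card F * b) → F) :=
    LinearEquiv.ofFinrankEq _ _ (by simp [Module.finrank_pi_fintype, h₁, h₂])
  let μ : (Fin (d * b ^ 3) → F) ≃ₗ[F] (Fin d → K₁) :=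
    LinearEquiv.ofFinrankEq _ _ (by simp [Module.finrank_pi_fintype, h₁])
  let C : CodeData F K₁ K₂ (Fin (2 * b * Fintype.card F)) m2 d m3 ((m2 + d) * b ^ 3) :=
    ⟨a₁, ha₁, a₂, ha₂, label, label.injective, coord, coord.injective⟩
  refine ⟨C.toCode m1 m4 φ μ.toEquiv, fun m5 m6 N hKB hHB hKE α hα => ?_⟩
  have hm : m2 ≤ m3 := by
    have := N.KB.rank_le_width
    omega
  refine ⟨?_, C.leakedInformation_toCode m1 m4 φ _ N α hα hm hKE⟩
  have h := C.errorProb_toCode_le m1 m4 φ μ.toEquiv N α hα hd hm hKB hHB hKE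
  rwa [hcard, Nat.card_fin] at h

theorem tendsto_error_bound (G q D : ℕ) (hq : 1 < q) :
    Tendsto (fun b : ℕ => (G * ((2 * b * q : ℕ) + (D * b ^ 3 : ℕ)) : ℝ) / (q ^ b : ℕ))
      atTop (𝓝 0) := by
  have hq' : (1 : ℝ) < q := by exact_mod_cast hq
  have h1 := (tendsto_pow_const_div_const_pow_of_one_lt 1 hq').const_mul (G * 2 * q : ℝ)
  have h3 := (tendsto_pow_const_div_const_pow_of_one_lt 3 hq').const_mul (G * D : ℝ)
  have h := h1.add h3
  rw [mul_zero, mul_zero, add_zero] at h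
  refine h.congr fun b => ?_
  push_cast
  ring

theorem tendsto_rate (d q : ℕ) :
    Tendsto (fun b : ℕ => ((d * b ^ 3 : ℕ) : ℝ) / ((b ^ 3 + 2 * b * q * b : ℕ) : ℝ))
      atTop (𝓝 d) := by
  have h1 : Tendsto (fun b : ℕ => (2 * q : ℝ) / (b : ℝ)) atTop (𝓝 0) :=
    tendsto_const_div_atTop_nhds_zero_nat _
  have h2 := (tendsto_const_nhds (x := (d : ℝ))).div (h1.const_add 1) (by norm_num)
  rw [add_zero, div_one] at h2
  refine h2.congr' ?_
  filter_upwards [eventually_gt_atTop 0] with b hb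
  have hb' : (0 : ℝ) < b := by exact_mod_cast hb
  simp only [Pi.div_apply]
  push_cast
  field_simp

theorem theorem3 {F : Type*} [Field F] [Finite F] (m0 m1 m2 m3 m4 : ℕ) (hm : m2 + m1 < m0) :
    ∃ (l k : ℕ → ℕ) (Φ : ∀ n, NonLocalCode F m3 m4 (l n) (k n)),
      Tendsto l atTop atTop ∧
      Tendsto (fun n => (k n : ℝ) / (l n : ℝ)) atTop (𝓝 ((m0 : ℝ) - m1 - m2)) ∧
      (∀ ε : ℝ, 0 < ε → ∃ n₀ : ℕ, ∀ n ≥ n₀, ∀ (m5 m6 : ℕ) (N : LinearNetwork F m3 m4 m5 m6),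
        N.KB.rank = m0 → N.HB.rank ≤ m1 → N.KE.rank ≤ m2 →
        ∀ (α : Strategy F m5 m6 (l n)) (hα : UniquenessCondition N α),
          errorProb (Φ n) N α hα ≤ ε) ∧
      (∀ (n m5 m6 : ℕ) (N : LinearNetwork F m3 m4 m5 m6),
        N.KB.rank = m0 → N.HB.rank ≤ m1 → N.KE.rank ≤ m2 →
        ∀ (α : Strategy F m5 m6 (l n)) (hα : UniquenessCondition N α),
          leakedInformation (Φ n) N α hα = 0) := by
  have := Fintype.ofFinite F
  obtain ⟨d, rfl⟩ : ∃ d, m0 = m1 + (m2 + d) := ⟨m0 - m1 - m2, by omega⟩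
  have hd : 0 < d := by omega
  set q := Fintype.card F with hq
  have hq1 : 1 < q := Fintype.one_lt_card
  -- The offset gives `b n > 0` and `m3 ≤ b n`, so both extensions contain `m3` independent elements
  -- for every `n`.
  let b : ℕ → ℕ := fun n => n + (m3 + 1)
  have hb : Tendsto b atTop atTop := tendsto_add_atTop_nat _
  choose Φ hΦ using fun n => exists_code F m1 m2 d m3 m4 (b n) hd (by simp only [b]; omega)
    (by simp only [b]; omega)
  refine ⟨fun n => b n ^ 3 + 2 * b n * q * b n, fun n => d * b n ^ 3, Φ, ?_, ?_, ?_, ?_⟩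
  · refine tendsto_atTop_mono (fun n => ?_) hb
    exact (Nat.le_self_pow (by norm_num) (b n)).trans (Nat.le_add_right _ _)
  · have h : ((m1 + (m2 + d) : ℕ) : ℝ) - m1 - m2 = d := by
      push_cast
      ring
    rw [h]
    exact (tendsto_rate d q).comp hb
  · intro ε hε
    have h := ((tendsto_error_bound (Nat.card (CodeData.Guess F m1 m3 m4 (m2 + d))) q (m2 + d)
      hq1).comp hb).eventually_le_const hε
    obtain ⟨n₀, hn₀⟩ := eventually_atTop.mp h
    exact ⟨n₀, fun n hn m5 m6 N hKB hHB hKE α hα =>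
      ((hΦ n m5 m6 N hKB hHB hKE α hα).1).trans (hn₀ n hn)⟩
  · exact fun n m5 m6 N hKB hHB hKE α hα => (hΦ n m5 m6 N hKB hHB hKE α hα).2
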